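/- Storage reallocation. Objects have names and positive integer lengths and are stored in disjoint intervals of cells of an infinite array with cells $0,1,2,\dots$. An execution is a finite sequence of requests, each of which either inserts a new object (a name that is not currently active, with a length $w\ge 1$) or deletes an active object. A cost-oblivious reallocator $A$ outputs, after each request, start addresses for all active objects (those inserted and not yet deleted) such that distinct active objects occupy disjoint intervals; this output depends only on the requests served so far, and in particular not on any cost function. The footprint of an allocation is the least $L$ such that all active objects lie in the cells $0,\dots,L-1$, and the volume $V_t$ is the total length of the objects active after $t$ requests. For a cost function $f$, the reallocation cost of a request is the sum of $f(w)$ over the lengths $w$ of all objects that are active both before and after the request and whose start addresses before and after it differ. $A$ is $(f,a,b)$-competitive if, for every execution, after every request, (1) the footprint is at most $a$ times the minimum footprint of any allocation of the active objects, and (2) the total reallocation cost so far is at most $b$ times the sum of $f(w)$ over the lengths $w$ of all objects inserted so far (including those deleted since). Theorem. There is an absolute constant $C>0$ such that for every $0<\varepsilon\le 1/2$ there is a cost-oblivious reallocator $A$ that is $\bigl(f,\,1+\varepsilon,\,C\,\tfrac1\varepsilon\log\tfrac1\varepsilon\bigr)$-competitive for every monotonically (weakly) increasing subadditive cost function $f$,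 i.e. every real-valued $f$ on the positive integers with $f(x)\le f(y)$ for $x\le y$ and $f(x+y)\le f(x)+f(y)$. Moreover, in every execution, after every request $t$, the footprint of $A$ is at most $(1+\varepsilon)V_t$. -/

import Mathlib

namespace StorageRealloc

universe u

/-- A request: insert an object with a given name and (integral) length, or delete the object
with a given name. -/
inductive Request (α : Type u) : Type u
  | insert (name : α) (length : ℕ)
  | delete (name : α)

variable {α : Type u}

/-- The lengths of the active objects after serving the requests in `h`, most recent request
first. A name is active iff its value is nonzero (lengths of objects are positive), so the support
is the set of active objects. -/
noncomputable def active : List (Request α) → α →₀ ℕ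
  | [] => 0
  | Request.insert n w :: h => (active h).update n w
  | Request.delete n :: h => (active h).erase n

/-- `IsExecution h`: the list `h` (most recent request first) is a legal sequence of requests. An
inserted object has positive length and its name is not in use; only active objects are deleted.
The name of a deleted object may be used again for a new object. -/
def IsExecution : List (Request α) → Prop
  | [] => True
  | Request.insert n w :: h => IsExecution h ∧ n ∉ (active h).support ∧ 0 < w
  | Request.delete n :: h => IsExecution h ∧ n ∈ (active h).support

/-- The volume: the total length of the objects in `s`. -/
def volume (s : α →₀ ℕ) : ℕ := ∑ n ∈ s.support, s n

/-- `x` gives every object of `s` a start address in the array of cells `0, 1, 2, …`, so that the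
object `n` occupies the cells `x n, …, x n + s n - 1`; distinct objects occupy disjoint sets of
cells. The values of `x` at names outside `s` are irrelevant. -/
def IsAllocation (s : α →₀ ℕ) (x : α → ℕ) : Prop :=
  (s.support : Set α).PairwiseDisjoint fun n => Set.Ico (x n) (x n + s n)

/-- The footprint: the length of the shortest prefix of the array that contains all objects. -/
def footprint (s : α →₀ ℕ) (x : α → ℕ) : ℕ := s.support.sup fun n => x n + s n

/-- A (deterministic, online) reallocator: after each request it outputs an allocation of the
active objects, which depends on the requests served so far and on nothing else. In particular no
cost function enters, so every reallocator in this sense is cost oblivious. -/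
structure Reallocator (α : Type u) where
  /-- the start addresses after the requests of the given history, most recent request first -/
  place : List (Request α) → α → ℕ
  isAllocation : ∀ h, IsExecution h → IsAllocation (active h) (place h)

/-- The cost, for the cost function `f`, of passing from the allocation `x` of the objects `s` to
the allocation `x'` of the objects `s'`: the sum of `f (length)` over all objects that are present
in both and have been moved. -/
def moveCost (f : ℕ → ℝ) (s s' : α →₀ ℕ) (x x' : α → ℕ) : ℝ :=
  ∑ n ∈ s.support with s' n ≠ 0 ∧ x n ≠ x' n, f (s n)

/-- The total reallocation cost of all requests in the history. -/
noncomputable def reallocCost (f : ℕ → ℝ) (A : Reallocator α) : List (Request α) → ℝ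
  | [] => 0
  | r :: h => reallocCost f A h +
      moveCost f (active h) (active (r :: h)) (A.place h) (A.place (r :: h))

/-- The sum of the allocation costs of all objects ever inserted, including those that have been
deleted since. -/
noncomputable def allocCost (f : ℕ → ℝ) : List (Request α) → ℝ
  | [] => 0
  | Request.insert _ w :: h => allocCost f h + f w
  | Request.delete _ :: h => allocCost f h

/-- Cost functions (of the positive integral length of an object) that are monotonically
increasing and subadditive. Such a function is automatically nonnegative at positive lengths. -/
structure IsSubadditiveCost (f : ℕ → ℝ) : Prop where
  mono : ∀ x y, 0 < x → x ≤ y → f x ≤ f y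
  subadd : ∀ x y, 0 < x → 0 < y → f (x + y) ≤ f x + f y

/-- `A` is `(f, a, b)`-competitive: at all times the footprint is at most `a` times the footprint
of any allocation of the active objects, hence of an optimal one, and the reallocation cost so far
is at most `b` times the sum of the allocation costs of all objects inserted so far. -/
def Reallocator.IsCompetitive (A : Reallocator α) (f : ℕ → ℝ) (a b : ℝ) : Prop :=
  ∀ h, IsExecution h →
    (∀ y, IsAllocation (active h) y →
      (footprint (active h) (A.place h) : ℝ) ≤ a * footprint (active h) y) ∧
    reallocCost f A h ≤ b * allocCost f h

end StorageRealloc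

namespace StorageRealloc

universe u

variable {α : Type u}

/-! ### Cost functions -/

/-! Group objects by length into dyadic classes. The array is a sequence of regions, one per class,
each a payload segment followed by a buffer of a `1 / N` fraction of it, with `N` about `4 / ε`.
Every request, deletions included, uses up room of its own length in the first buffer, at or above
its class, that has enough; then nothing moves. If no buffer has room, all regions from a suitable
class `b` on are rebuilt without gaps.

Footprint: payloads differ from the current class volumes only by recorded requests, whose total
length is at most a `1 / N` fraction of the payloads (`State.Inv.footprint_le`).

Cost: by monotonicity and subadditivity, a cell of a longer object costs at most about twice as much
as a cell of a shorter one, whatever `f` is. So requests of class at most `j` can pay for moving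
class `j` in proportion to length. Each rebuilt class `j` has a request that did not fit into its
buffer (`exists_of_cut_le`, or the request causing the flush). Hence either the buffer is at least
half full and its entries pay, or that request is itself longer than a `1 / (2 * N)` fraction of the
payload, which happens for only `O(log N)` classes per request (`class_cost_le`). Each request thus
pays `O(N log N)` times its own cost, once, since a flush discards the entries that paid
(`State.Inv.cost_flush`). An insertion prepays the deletion of its object (`reallocCost_le`). -/

theorem IsSubadditiveCost.nonneg {f : ℕ → ℝ} (hf : IsSubadditiveCost f) {x : ℕ} (hx : 0 < x) :
    0 ≤ f x := by
  have h₁ := hf.mono x (x + x) hx (by omega)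
  have h₂ := hf.subadd x x hx hx
  linarith

theorem IsSubadditiveCost.mul_le {f : ℕ → ℝ} (hf : IsSubadditiveCost f) {x : ℕ} (hx : 0 < x)
    (k : ℕ) : f ((k + 1) * x) ≤ (k + 1) * f x := by
  induction k with
  | zero => simp
  | succ k ih =>
    have h := hf.subadd ((k + 1) * x) x (by positivity) hx
    have e : (k + 1 + 1) * x = (k + 1) * x + x := by ring
    rw [e]
    push_cast
    linarith

/-- The price per cell of longer objects is at most twice that of shorter ones. -/
theorem IsSubadditiveCost.price_le {f : ℕ → ℝ} (hf : IsSubadditiveCost f) {x y : ℕ} (hx : 0 < x)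
    (hxy : x < 2 * y) : x * f y ≤ 2 * y * f x := by
  have hy : 0 < y := by omega
  have hfx := hf.nonneg hx
  have hxy' : (x : ℝ) ≤ 2 * y := by exact_mod_cast hxy.le
  rcases le_total y x with h | h
  · have h₁ := hf.mono y x hy h
    have h₂ := hf.nonneg hy
    calc (x : ℝ) * f y ≤ x * f x := by gcongr
      _ ≤ 2 * y * f x := by gcongr
  · have h₁ : y ≤ (y / x + 1) * x := by
      have := Nat.div_add_mod y x
      have := Nat.mod_lt y hx
      nlinarith
    -- Cover `y` by `y / x + 1` copies of `x`; as `x ≤ y`, rounding up at most doubles the length.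
    have h₂ := (hf.mono _ _ hy h₁).trans (hf.mul_le hx (y / x))
    have h₃ : x * (y / x + 1) ≤ 2 * y := by
      have := Nat.mul_div_le y x
      nlinarith
    have h₄ : (x : ℝ) * ((y / x : ℕ) + 1) ≤ 2 * y := by exact_mod_cast h₃
    calc (x : ℝ) * f y ≤ x * (((y / x : ℕ) + 1) * f x) := by gcongr
      _ = x * ((y / x : ℕ) + 1) * f x := by ring
      _ ≤ 2 * y * f x := by gcongr

/-! ### Sums over lists -/

theorem cast_sum_mul_le {ι : Type*} (E : List ι) (g : ι → ℕ) (k : ι → ℝ) (q : ℝ)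
    (h : ∀ p ∈ E, g p * q ≤ k p) : ((E.map g).sum : ℝ) * q ≤ (E.map k).sum := by
  induction E with
  | nil => simp
  | cons a E ih =>
    have h₁ := h a (by simp)
    have h₂ := ih fun p hp => h p (by simp [hp])
    simp only [List.map_cons, List.sum_cons, Nat.cast_add]
    linarith

theorem finset_sum_list_sum {ι : Type*} (I : Finset ℕ) (E : List ι) (g : ℕ → ι → ℝ) :
    ∑ j ∈ I, (E.map (g j)).sum = (E.map fun p => ∑ j ∈ I, g j p).sum := by
  induction E with
  | nil => simp
  | cons a E ih => simp [Finset.sum_add_distrib, ih]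

theorem le_list_sum {ι : Type*} (E : List ι) (g : ι → ℝ) (h : ∀ p ∈ E, 0 ≤ g p) {a : ι}
    (ha : a ∈ E) : g a ≤ (E.map g).sum :=
  List.single_le_sum (by simpa using h) _ (List.mem_map_of_mem ha)

/-! ### Entries of the buffers -/

/-- The total length of the entries in buffer `j`; an entry is a pair of a length and a buffer. -/
def fill (E : List (ℕ × ℕ)) (j : ℕ) : ℕ := (E.map fun p => if p.2 = j then p.1 else 0).sum

/-- The total length of the entries of size class `j`. -/
def pending (E : List (ℕ × ℕ)) (j : ℕ) : ℕ :=
  (E.map fun p => if Nat.log 2 p.1 = j then p.1 else 0).sum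

theorem fill_cons (w i : ℕ) (E : List (ℕ × ℕ)) (j : ℕ) :
    fill ((w, i) :: E) j = (if i = j then w else 0) + fill E j := by simp [fill]

theorem pending_cons (w i : ℕ) (E : List (ℕ × ℕ)) (j : ℕ) :
    pending ((w, i) :: E) j = (if Nat.log 2 w = j then w else 0) + pending E j := by simp [pending]

theorem sum_map_filter_of_eq_zero {ι : Type*} (E : List ι) (g : ι → ℕ) (Q : ι → Prop)
    [DecidablePred Q] (h : ∀ p ∈ E, ¬ Q p → g p = 0) :
    ((E.filter (fun p => Q p)).map g).sum = (E.map g).sum := by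
  induction E with
  | nil => rfl
  | cons a E ih =>
    have ih := ih fun p hp => h p (by simp [hp])
    by_cases ha : Q a
    · simp [ha, ih]
    · simp [ha, ih, h a (by simp) ha]

/-- The cost of reallocating a size class, charged to the entries of the buffers. -/
theorem class_cost_le {f : ℕ → ℝ} (hf : IsSubadditiveCost f) {N j P v : ℕ} {T : ℝ}
    (hN : 0 < N) (E : List (ℕ × ℕ)) (hT0 : 0 ≤ T)
    (hT : ∀ x, 0 < x → Nat.log 2 x ≤ j → x * T ≤ 2 * v * f x)
    (hv : v ≤ P + pending E j) (hP : P = 0 ∨ 2 ^ j ≤ P)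
    (hE : ∀ p ∈ E, 0 < p.1 ∧ Nat.log 2 p.1 ≤ p.2)
    (hpay : ∃ p ∈ E, Nat.log 2 p.1 ≤ j ∧ P < N * (fill E j + p.1)) :
    T ≤ (E.map fun p => ((if Nat.log 2 p.1 = j then 2 else 0) + (if p.2 = j then 4 * (N : ℝ) else 0)
      + (if Nat.log 2 p.1 ≤ j ∧ j < Nat.log 2 p.1 + (Nat.log 2 N + 3) then 4 * (N : ℝ) else 0))
      * f p.1).sum := by
  have key : ∀ p ∈ E, 0 ≤ f p.1 := fun p hp => hf.nonneg (hE p hp).1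
  have hsplit : (E.map fun p => ((if Nat.log 2 p.1 = j then 2 else 0) +
      (if p.2 = j then 4 * (N : ℝ) else 0)
      + (if Nat.log 2 p.1 ≤ j ∧ j < Nat.log 2 p.1 + (Nat.log 2 N + 3) then 4 * (N : ℝ) else 0))
      * f p.1).sum = (E.map fun p => (if Nat.log 2 p.1 = j then 2 else 0) * f p.1).sum +
      (E.map fun p => (if p.2 = j then 4 * (N : ℝ) else 0) * f p.1).sum +
      (E.map fun p => (if Nat.log 2 p.1 ≤ j ∧ j < Nat.log 2 p.1 + (Nat.log 2 N + 3)
        then 4 * (N : ℝ) else 0) * f p.1).sum := by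
    simp only [add_mul, List.sum_map_add]
  rw [hsplit]
  have n₁ : 0 ≤ (E.map fun p => (if Nat.log 2 p.1 = j then (2 : ℝ) else 0) * f p.1).sum :=
    List.sum_nonneg (by
      simp only [List.mem_map, forall_exists_index, and_imp]
      rintro _ p hp rfl
      have := key p hp
      positivity)
  have n₂ : 0 ≤ (E.map fun p => (if p.2 = j then 4 * (N : ℝ) else 0) * f p.1).sum :=
    List.sum_nonneg (by
      simp only [List.mem_map, forall_exists_index, and_imp]
      rintro _ p hp rfl
      have := key p hp
      positivity)
  have n₃' : ∀ p ∈ E, 0 ≤ (if Nat.log 2 p.1 ≤ j ∧ j < Nat.log 2 p.1 + (Nat.log 2 N + 3)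
        then 4 * (N : ℝ) else 0) * f p.1 := by
    intro p hp
    have := key p hp
    positivity
  have n₃ : 0 ≤ (E.map fun p => (if Nat.log 2 p.1 ≤ j ∧ j < Nat.log 2 p.1 + (Nat.log 2 N + 3)
        then 4 * (N : ℝ) else 0) * f p.1).sum :=
    List.sum_nonneg (by
      simp only [List.mem_map, forall_exists_index, and_imp]
      rintro _ p hp rfl
      exact n₃' p hp)
  rcases Nat.eq_zero_or_pos v with hv0 | hv0
  · have := hT 1 one_pos (by simp)
    simp only [hv0, Nat.cast_one, one_mul, Nat.cast_zero, mul_zero, zero_mul] at this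
    linarith
  have hvR : (0 : ℝ) < v := by exact_mod_cast hv0
  -- The price per cell of class `j`. Entries of class at most `j` cost at least half of it per
  -- cell.
  obtain ⟨q, hq⟩ : ∃ q, q = T / v := ⟨_, rfl⟩
  have hTq : T = v * q := by rw [hq]; field_simp
  have hq0 : 0 ≤ q := by rw [hq]; positivity
  have hxq : ∀ x : ℕ, 0 < x → Nat.log 2 x ≤ j → x * q ≤ 2 * f x := by
    intro x hx hxj
    have h := hT x hx hxj
    rw [hTq] at h
    refine le_of_mul_le_mul_left ?_ hvR
    linarith
  have hpend : (pending E j : ℝ) * q ≤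
      (E.map fun p => (if Nat.log 2 p.1 = j then (2 : ℝ) else 0) * f p.1).sum := by
    refine cast_sum_mul_le _ _ _ _ fun p hp => ?_
    split_ifs with h
    · exact hxq _ (hE p hp).1 h.le
    · simp
  have hfill : 2 * (N : ℝ) * (fill E j * q) ≤
      (E.map fun p => (if p.2 = j then 4 * (N : ℝ) else 0) * f p.1).sum := by
    have : (fill E j : ℝ) * (2 * N * q) ≤
        (E.map fun p => (if p.2 = j then 4 * (N : ℝ) else 0) * f p.1).sum := by
      refine cast_sum_mul_le _ _ _ _ fun p hp => ?_
      split_ifs with h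
      · have h₁ := hxq _ (hE p hp).1 ((hE p hp).2.trans h.le)
        have h₂ : 2 * (N : ℝ) * (p.1 * q) ≤ 2 * N * (2 * f p.1) := by gcongr
        linarith
      · simp
    linarith
  have hvq : T ≤ P * q + pending E j * q := by
    rw [hTq, ← add_mul]
    gcongr
    exact_mod_cast hv
  have hPq : (P : ℝ) * q ≤ (E.map fun p => (if p.2 = j then 4 * (N : ℝ) else 0) * f p.1).sum +
      (E.map fun p => (if Nat.log 2 p.1 ≤ j ∧ j < Nat.log 2 p.1 + (Nat.log 2 N + 3)
        then 4 * (N : ℝ) else 0) * f p.1).sum := by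
    -- Which summand of `fill E j + p.1` dominates: either the buffer's entries pay for the payload,
    -- or the single request `p` that did not fit does.
    by_cases hc : P ≤ 2 * N * fill E j
    · have : (P : ℝ) * q ≤ 2 * N * fill E j * q := by
        gcongr
        exact_mod_cast hc
      linarith
    · obtain ⟨p, hp, hpj, hpP⟩ := hpay
      have hP2 : P < 2 * N * p.1 := by nlinarith
      have hlt : j < Nat.log 2 p.1 + (Nat.log 2 N + 3) := by
        have h₁ := Nat.lt_pow_succ_log_self (b := 2) (by norm_num) p.1
        have h₂ := Nat.lt_pow_succ_log_self (b := 2) (by norm_num) N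
        -- A nonempty payload of class `j` has at least `2 ^ j` cells, so `p` can be charged this
        -- way only for the `Nat.log 2 N + 3` classes starting at its own.
        have h₃ : 2 ^ j ≤ P := hP.resolve_left (by omega)
        rw [← Nat.pow_lt_pow_iff_right (a := 2) (by norm_num)]
        calc 2 ^ j ≤ P := h₃
          _ < 2 * N * p.1 := hP2
          _ ≤ 2 * 2 ^ (Nat.log 2 N + 1) * 2 ^ (Nat.log 2 p.1 + 1) := by gcongr
          _ = 2 ^ (Nat.log 2 p.1 + (Nat.log 2 N + 3)) := by ring
      have h₁ := le_list_sum E _ n₃' hp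
      rw [if_pos ⟨hpj, hlt⟩] at h₁
      have h₂ := hxq _ (hE p hp).1 hpj
      have h₃ : (P : ℝ) * q ≤ 2 * N * p.1 * q := by
        gcongr
        exact_mod_cast hP2.le
      have h₄ : 2 * (N : ℝ) * (p.1 * q) ≤ 2 * N * (2 * f p.1) := by gcongr
      linarith
  linarith

/-- The cost of reallocating the size classes in an interval, charged to the entries. -/
theorem sum_class_cost_le {f : ℕ → ℝ} (hf : IsSubadditiveCost f) {N b M : ℕ} {P v : ℕ → ℕ}
    {T : ℕ → ℝ} (hN : 0 < N) (E : List (ℕ × ℕ)) (hT0 : ∀ j, 0 ≤ T j)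
    (hT : ∀ j x, 0 < x → Nat.log 2 x ≤ j → x * T j ≤ 2 * v j * f x)
    (hv : ∀ j, b ≤ j → v j ≤ P j + pending E j) (hP : ∀ j, P j = 0 ∨ 2 ^ j ≤ P j)
    (hE : ∀ p ∈ E, 0 < p.1 ∧ Nat.log 2 p.1 ≤ p.2)
    (hpay : ∀ j, b ≤ j → j < M → ∃ p ∈ E, Nat.log 2 p.1 ≤ j ∧ P j < N * (fill E j + p.1)) :
    ∑ j ∈ Finset.Ico b M, T j ≤
      (2 + 4 * N + 4 * N * (Nat.log 2 N + 3 : ℕ)) * (E.map fun p => f p.1).sum := by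
  refine (Finset.sum_le_sum fun j hj => class_cost_le hf hN E (hT0 j) (hT j)
    (hv j (Finset.mem_Ico.1 hj).1) (hP j) hE
    (hpay j (Finset.mem_Ico.1 hj).1 (Finset.mem_Ico.1 hj).2)).trans ?_
  rw [finset_sum_list_sum, ← List.sum_map_mul_left]
  refine List.sum_le_sum fun p hp => ?_
  rw [← Finset.sum_mul]
  refine mul_le_mul_of_nonneg_right ?_ (hf.nonneg (hE p hp).1)
  rw [Finset.sum_add_distrib, Finset.sum_add_distrib]
  -- Per entry: one class as its own, one class as its buffer, and `Nat.log 2 N + 3` classes as a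
  -- request that did not fit.
  refine add_le_add (add_le_add ?_ ?_) ?_
  · rw [Finset.sum_ite_eq]
    split_ifs <;> norm_num
  · rw [Finset.sum_ite_eq]
    split_ifs
    · exact le_rfl
    · positivity
  · rw [← Finset.sum_filter, Finset.sum_const, nsmul_eq_mul, mul_comm]
    gcongr
    refine (Finset.card_le_card (t := Finset.Ico (Nat.log 2 p.1)
      (Nat.log 2 p.1 + (Nat.log 2 N + 3))) ?_).trans (by simp)
    intro j hj
    simp only [Finset.mem_filter] at hj
    exact Finset.mem_Ico.2 hj.2

/-! ### Size classes -/

/-- The objects of size class `j`, i.e. of length at least `2 ^ j` and less than `2 ^ (j + 1)`. -/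
def classOf (s : α →₀ ℕ) (j : ℕ) : Finset α := {m ∈ s.support | Nat.log 2 (s m) = j}

/-- The total length of the objects of size class `j`. -/
def classVol (s : α →₀ ℕ) (j : ℕ) : ℕ := ∑ m ∈ classOf s j, s m

theorem mem_classOf {s : α →₀ ℕ} {j : ℕ} {m : α} :
    m ∈ classOf s j ↔ s m ≠ 0 ∧ Nat.log 2 (s m) = j := by
  simp [classOf]

theorem sum_support_update {M : Type*} [AddCommMonoid M] (s : α →₀ ℕ) {n : α} {w : ℕ}
    (hn : s n = 0) (hw : 0 < w) (g : ℕ → M) :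
    ∑ m ∈ (s.update n w).support, g (s.update n w m) = g w + ∑ m ∈ s.support, g (s m) := by
  classical
  rw [Finsupp.support_update_ne_zero _ _ hw.ne', Finset.sum_insert (by simpa using hn)]
  congr 1
  · simp
  · refine Finset.sum_congr rfl fun m hm => ?_
    have : m ≠ n := by
      rintro rfl
      simp [hn] at hm
    simp [Finsupp.coe_update, Function.update_of_ne this]

theorem classVol_update (s : α →₀ ℕ) {n : α} {w : ℕ} (hn : s n = 0) (hw : 0 < w) (j : ℕ) :
    classVol (s.update n w) j = (if Nat.log 2 w = j then w else 0) + classVol s j := by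
  have h := sum_support_update s hn hw fun v => if Nat.log 2 v = j then v else 0
  simpa only [classVol, classOf, Finset.sum_filter] using h

theorem sum_classVol (s : α →₀ ℕ) {M : ℕ} (hM : ∀ m ∈ s.support, Nat.log 2 (s m) < M) :
    ∑ j ∈ Finset.range M, classVol s j = volume s :=
  Finset.sum_fiberwise_of_maps_to (fun m hm => Finset.mem_range.2 (hM m hm)) _

/-- `s` and `s'` differ only in the object `n`, of length `w`, which is in exactly one of them. -/
def IsUpdate (s s' : α →₀ ℕ) (n : α) (w : ℕ) : Prop :=
  0 < w ∧ ((s n = 0 ∧ s' = s.update n w) ∨ (s' n = 0 ∧ s = s'.update n w))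

theorem IsUpdate.symm {s s' : α →₀ ℕ} {n : α} {w : ℕ} (h : IsUpdate s s' n w) :
    IsUpdate s' s n w := ⟨h.1, h.2.symm⟩

theorem IsUpdate.apply_of_ne {s s' : α →₀ ℕ} {n m : α} {w : ℕ} (h : IsUpdate s s' n w)
    (hm : m ≠ n) : s' m = s m := by
  classical
  rcases h.2 with ⟨_, rfl⟩ | ⟨_, rfl⟩ <;> simp [Finsupp.coe_update, Function.update_of_ne hm]

theorem IsUpdate.apply_self {s s' : α →₀ ℕ} {n : α} {w : ℕ} (h : IsUpdate s s' n w) :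
    s' n = 0 ∨ s' n = w := by
  classical
  rcases h.2 with ⟨_, rfl⟩ | ⟨h, _⟩
  · simp [Finsupp.coe_update]
  · exact .inl h

theorem IsUpdate.apply_self_eq_zero {s s' : α →₀ ℕ} {n : α} {w : ℕ} (h : IsUpdate s s' n w) :
    s n = 0 ∨ s' n = 0 := h.2.imp And.left And.left

theorem IsUpdate.classVol_le {s s' : α →₀ ℕ} {n : α} {w : ℕ} (h : IsUpdate s s' n w) (j : ℕ) :
    classVol s' j ≤ classVol s j + (if Nat.log 2 w = j then w else 0) := by
  rcases h.2 with ⟨h0, rfl⟩ | ⟨h0, rfl⟩ <;> rw [classVol_update _ h0 h.1] <;> omega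

/-! ### The layout of the array and the reallocation step -/

/-- The first cell of the region of size class `j`: each region consists of a payload segment of
`P i` cells and of a buffer of `P i / N` cells. -/
def start (N : ℕ) (P : ℕ → ℕ) (j : ℕ) : ℕ := ∑ i ∈ Finset.range j, (P i + P i / N)

theorem start_succ (N : ℕ) (P : ℕ → ℕ) (j : ℕ) :
    start N P (j + 1) = start N P j + P j + P j / N := by
  rw [start, Finset.sum_range_succ, ← start, add_assoc]

theorem start_mono (N : ℕ) (P : ℕ → ℕ) : Monotone (start N P) :=
  monotone_nat_of_le_succ fun j => by
    rw [start_succ, add_assoc]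
    exact Nat.le_add_right _ _

theorem start_congr {N : ℕ} {P Q : ℕ → ℕ} {j : ℕ} (h : ∀ i < j, P i = Q i) :
    start N P j = start N Q j :=
  Finset.sum_congr rfl fun i hi => by rw [h i (Finset.mem_range.1 hi)]

theorem exists_pack (T : Finset α) (s : α → ℕ) :
    ∃ x : α → ℕ, ((T : Set α).PairwiseDisjoint fun n => Set.Ico (x n) (x n + s n)) ∧
      ∀ n ∈ T, x n + s n ≤ ∑ m ∈ T, s m := by
  classical
  induction T using Finset.induction_on with
  | empty => exact ⟨fun _ => 0, by simp, by simp⟩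
  | insert a T ha ih =>
    obtain ⟨x, hx, hle⟩ := ih
    have hne : ∀ m ∈ T, m ≠ a := fun m hm h => ha (h ▸ hm)
    refine ⟨Function.update x a (∑ m ∈ T, s m), ?_, ?_⟩
    · rw [Finset.coe_insert, Set.pairwiseDisjoint_insert]
      constructor
      · intro m hm k hk hmk
        have := hx hm hk hmk
        simpa [Function.onFun, Function.update_of_ne (hne m hm), Function.update_of_ne (hne k hk)]
          using this
      · intro m hm _
        rw [Function.update_self, Function.update_of_ne (hne m hm)]
        exact (Set.Ico_disjoint_Ico_same.mono_left (Set.Ico_subset_Ico_right (hle m hm))).symm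
    · intro m hm
      rw [Finset.sum_insert ha]
      rcases Finset.mem_insert.1 hm with rfl | hm
      · rw [Function.update_self]; omega
      · rw [Function.update_of_ne (hne m hm)]
        have := hle m hm
        omega

/-- Offsets that pack the objects of a size class without gaps. -/
noncomputable def pack (s : α →₀ ℕ) (j : ℕ) : α → ℕ := (exists_pack (classOf s j) s).choose

theorem pack_disjoint (s : α →₀ ℕ) (j : ℕ) : (classOf s j : Set α).PairwiseDisjoint
    fun n => Set.Ico (pack s j n) (pack s j n + s n) :=
  (exists_pack (classOf s j) s).choose_spec.1

theorem pack_le {s : α →₀ ℕ} {j : ℕ} {m : α} (hm : m ∈ classOf s j) :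
    pack s j m + s m ≤ classVol s j :=
  (exists_pack (classOf s j) s).choose_spec.2 m hm

/-- The state of the reallocator: the sizes of the payload segments, the entries of the buffers
(one for each request since the last flush of its buffer, as pairs of a length and a buffer) and
the start addresses of the objects. -/
structure State (α : Type u) where
  payload : ℕ → ℕ
  entries : List (ℕ × ℕ)
  place : α → ℕ

/-- Record a request for the object `n` of length `w` in buffer `j`. -/
noncomputable def State.record (N : ℕ) (σ : State α) (n : α) (w j : ℕ) : State α :=
  open Classical in
  { payload := σ.payload
    entries := (w, j) :: σ.entries
    place := Function.update σ.place n
      (start N σ.payload j + σ.payload j + fill σ.entries j) }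

/-- The sizes of the payload segments after a flush of the size classes from `b` on. -/
def flushPayload (P : ℕ → ℕ) (s : α →₀ ℕ) (b j : ℕ) : ℕ := if j < b then P j else classVol s j

/-- Rebuild the regions of the size classes from `b` on for the objects `s`. -/
noncomputable def State.flush (N : ℕ) (σ : State α) (s : α →₀ ℕ) (b : ℕ) : State α where
  payload := flushPayload σ.payload s b
  entries := σ.entries.filter fun p => p.2 < b
  place m := if Nat.log 2 (s m) < b then σ.place m else
    start N (flushPayload σ.payload s b) (Nat.log 2 (s m)) + pack s (Nat.log 2 (s m)) m

/-- No entry of a size class below `b` is in a buffer from `b` on. -/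
def IsCut (E : List (ℕ × ℕ)) (b : ℕ) : Prop := ∀ p ∈ E, Nat.log 2 p.1 < b → p.2 < b

open Classical in
/-- The largest cut up to `c`. -/
noncomputable def cut (E : List (ℕ × ℕ)) (c : ℕ) : ℕ := Nat.findGreatest (IsCut E) c

theorem isCut_cut (E : List (ℕ × ℕ)) (c : ℕ) : IsCut E (cut E c) := by
  classical
  exact Nat.findGreatest_spec (P := IsCut E) (Nat.zero_le c) fun p _ h => absurd h (by omega)

theorem cut_le (E : List (ℕ × ℕ)) (c : ℕ) : cut E c ≤ c := by
  classical
  exact Nat.findGreatest_le c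

/-- Since `j + 1` is not a cut, some entry straddles it. That entry passed over buffer `j`, so it
can witness that buffer `j` had too little room. -/
theorem exists_of_cut_le {E : List (ℕ × ℕ)} {c j : ℕ} (h : cut E c ≤ j) (hj : j < c) :
    ∃ p ∈ E, Nat.log 2 p.1 ≤ j ∧ j < p.2 := by
  classical
  have := Nat.findGreatest_is_greatest (P := IsCut E) (n := c) (k := j + 1)
    (Nat.lt_succ_of_le h) hj
  simp only [IsCut, not_forall, not_lt] at this
  obtain ⟨p, hp, h₁, h₂⟩ := this
  exact ⟨p, hp, by omega, by omega⟩

/-- Buffer `j` is admissible and has room for a request of length `w`. -/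
def Fits (N : ℕ) (σ : State α) (w j : ℕ) : Prop :=
  Nat.log 2 w ≤ j ∧ N * (fill σ.entries j + w) ≤ σ.payload j

open Classical in
/-- Serve a request for the object `n` of length `w`, after which the active objects are `s`: record
it in the first buffer with room for it, or else flush. -/
noncomputable def State.step (N : ℕ) (σ : State α) (s : α →₀ ℕ) (n : α) (w : ℕ) : State α :=
  if h : ∃ j, Fits N σ w j then σ.record N n w (Nat.find h)
  else σ.flush N s (cut σ.entries (Nat.log 2 w))

/-- The invariants of the reallocator. -/
structure State.Inv (N : ℕ) (s : α →₀ ℕ) (σ : State α) : Prop where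
  isAllocation : IsAllocation s σ.place
  located : ∀ m, s m ≠ 0 → ∃ j, start N σ.payload j ≤ σ.place m ∧
    σ.place m + s m ≤ start N σ.payload j + σ.payload j + fill σ.entries j ∧
    (Nat.log 2 (s m) = j ∨ (s m, j) ∈ σ.entries)
  -- The last clause says that `p` would not fit into the buffers it passed over. It persists
  -- because fills only grow until a flush, and a flush reaching one of those buffers also discards
  -- `p`.
  entry : ∀ p ∈ σ.entries, 0 < p.1 ∧ Nat.log 2 p.1 ≤ p.2 ∧
    ∀ i, Nat.log 2 p.1 ≤ i → i < p.2 → σ.payload i < N * (fill σ.entries i + p.1)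
  fill_le : ∀ j, N * fill σ.entries j ≤ σ.payload j
  payload : ∀ j, σ.payload j = 0 ∨ 2 ^ j ≤ σ.payload j
  classVol_le : ∀ j, classVol s j ≤ σ.payload j + pending σ.entries j
  le_classVol : ∀ j, σ.payload j ≤ classVol s j + pending σ.entries j

/-! ### Preservation of the invariants -/

theorem disjoint_of_region {N : ℕ} {P : ℕ → ℕ} {e : ℕ → ℕ} (hN : 0 < N) (he : ∀ j, N * e j ≤ P j)
    {i j x v y u : ℕ} (hij : i ≠ j) (hx : start N P i ≤ x) (hx' : x + v ≤ start N P i + P i + e i)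
    (hy : start N P j ≤ y) (hy' : y + u ≤ start N P j + P j + e j) :
    Disjoint (Set.Ico x (x + v)) (Set.Ico y (y + u)) := by
  have key : ∀ k, start N P k + P k + e k ≤ start N P (k + 1) := fun k => by
    rw [start_succ]
    have := (Nat.le_div_iff_mul_le hN).2 (mul_comm N _ ▸ he k)
    omega
  have ki := key i
  have kj := key j
  rw [Set.Ico_disjoint_Ico]
  rcases lt_or_gt_of_ne hij with h | h
  · have := start_mono N P (Nat.succ_le_of_lt h)
    simp only [Nat.succ_eq_add_one] at this
    omega
  · have := start_mono N P (Nat.succ_le_of_lt h)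
    simp only [Nat.succ_eq_add_one] at this
    omega

theorem State.Inv.record {N : ℕ} (hN : 0 < N) {s s' : α →₀ ℕ} {σ : State α} {n : α} {w j : ℕ}
    (h : σ.Inv N s) (hu : IsUpdate s s' n w) (hfit : Fits N σ w j)
    (hfirst : ∀ i < j, ¬ Fits N σ w i) : (σ.record N n w j).Inv N s' := by
  classical
  have hmono : ∀ i, fill σ.entries i ≤ fill ((w, j) :: σ.entries) i := fun i => by
    rw [fill_cons]; omega
  have hself : fill ((w, j) :: σ.entries) j = w + fill σ.entries j := by simp [fill_cons]
  have hfill : ∀ i, N * fill ((w, j) :: σ.entries) i ≤ σ.payload i := by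
    intro i
    rw [fill_cons]
    split_ifs with hi
    · subst hi
      rw [add_comm]
      exact hfit.2
    · simpa using h.fill_le i
  have hloc : ∀ m, m ≠ n → s' m ≠ 0 → ∃ i, start N σ.payload i ≤ σ.place m ∧
      σ.place m + s' m ≤ start N σ.payload i + σ.payload i + fill σ.entries i ∧
      (Nat.log 2 (s' m) = i ∨ (s' m, i) ∈ σ.entries) := by
    intro m hm hm0
    rw [hu.apply_of_ne hm] at hm0 ⊢
    exact h.located m hm0
  have hnew : ∀ m, m ≠ n → s' m ≠ 0 → Disjoint (Set.Ico (σ.place m) (σ.place m + s' m))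
      (Set.Ico (start N σ.payload j + σ.payload j + fill σ.entries j)
        (start N σ.payload j + σ.payload j + fill σ.entries j + w)) := by
    intro m hm hm0
    obtain ⟨i, h₁, h₂, -⟩ := hloc m hm hm0
    by_cases hij : i = j
    · subst hij
      rw [Set.Ico_disjoint_Ico]
      omega
    · refine disjoint_of_region hN hfill hij h₁ (h₂.trans ?_) (by omega) ?_
      · have := hmono i
        omega
      · rw [hself]
        omega
  constructor
  · intro m hm k hk hmk
    have hm0 : s' m ≠ 0 := by simpa using hm
    have hk0 : s' k ≠ 0 := by simpa using hk
    simp only [Function.onFun, State.record]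
    by_cases hmn : m = n
    · subst hmn
      rw [Function.update_self, Function.update_of_ne (Ne.symm hmk),
        hu.apply_self.resolve_left hm0]
      exact (hnew k (Ne.symm hmk) hk0).symm
    · rw [Function.update_of_ne hmn]
      by_cases hkn : k = n
      · subst hkn
        rw [Function.update_self, hu.apply_self.resolve_left hk0]
        exact hnew m hmn hm0
      · rw [Function.update_of_ne hkn]
        rw [hu.apply_of_ne hmn] at hm0 ⊢
        rw [hu.apply_of_ne hkn] at hk0 ⊢
        exact h.isAllocation (by simpa using hm0) (by simpa using hk0) hmk
  · intro m hm0
    simp only [State.record]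
    by_cases hmn : m = n
    · subst hmn
      rw [hu.apply_self.resolve_left hm0]
      refine ⟨j, ?_, ?_, .inr (by simp)⟩
      · rw [Function.update_self]; omega
      · rw [Function.update_self, hself]; omega
    · rw [Function.update_of_ne hmn]
      obtain ⟨i, h₁, h₂, h₃⟩ := hloc m hmn hm0
      refine ⟨i, h₁, h₂.trans ?_, h₃.imp_right fun h => by simp [h]⟩
      have := hmono i
      omega
  · intro p hp
    simp only [State.record, List.mem_cons] at hp ⊢
    rcases hp with rfl | hp
    · refine ⟨hu.1, hfit.1, fun i hi hij => ?_⟩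
      have := hfirst i hij
      simp only [Fits, hi, true_and, not_le] at this
      exact this.trans_le (Nat.mul_le_mul_left _ (Nat.add_le_add_right (hmono i) _))
    · obtain ⟨h₁, h₂, h₃⟩ := h.entry p hp
      exact ⟨h₁, h₂, fun i hi hij => (h₃ i hi hij).trans_le
        (Nat.mul_le_mul_left _ (Nat.add_le_add_right (hmono i) _))⟩
  · exact hfill
  · exact h.payload
  · intro i
    simp only [State.record, pending_cons]
    have h₁ := hu.classVol_le i
    have h₂ := h.classVol_le i
    omega
  · intro i
    simp only [State.record, pending_cons]
    have h₁ := hu.symm.classVol_le i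
    have h₂ := h.le_classVol i
    omega

theorem fill_filter_lt {E : List (ℕ × ℕ)} {b j : ℕ} (hj : j < b) :
    fill (E.filter fun p => p.2 < b) j = fill E j :=
  sum_map_filter_of_eq_zero E _ (fun p => p.2 < b) fun p _ hp => if_neg (by omega)

theorem fill_filter_lt_of_le {E : List (ℕ × ℕ)} {b j : ℕ} (hj : b ≤ j) :
    fill (E.filter fun p => p.2 < b) j = 0 := by
  rw [fill, List.sum_eq_zero]
  simp only [List.mem_map, List.mem_filter, decide_eq_true_eq]
  rintro _ ⟨p, hp, rfl⟩
  exact if_neg (by omega)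

theorem pending_filter_lt {E : List (ℕ × ℕ)} {b j : ℕ} (hb : IsCut E b) (hj : j < b) :
    pending (E.filter fun p => p.2 < b) j = pending E j :=
  sum_map_filter_of_eq_zero E _ (fun p => p.2 < b) fun p hp hpb => if_neg fun h =>
    hpb (hb p hp (by omega))

/-- A cut separates the two sides completely: objects of class below `b` lie in regions below `b`,
and pending requests of class below `b` in buffers below `b`. The lower regions can therefore stay
as they are. The condition `b ≤ Nat.log 2 w` puts the current request among the rebuilt classes. -/
theorem State.Inv.flush {N : ℕ} (hN : 0 < N) {s s' : α →₀ ℕ} {σ : State α} {n : α} {w b : ℕ}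
    (h : σ.Inv N s) (hu : IsUpdate s s' n w) (hb : IsCut σ.entries b) (hbw : b ≤ Nat.log 2 w) :
    (σ.flush N s' b).Inv N s' := by
  have hPlt : ∀ j, j < b → flushPayload σ.payload s' b j = σ.payload j := fun j hj => if_pos hj
  have hPge : ∀ j, b ≤ j → flushPayload σ.payload s' b j = classVol s' j := fun j hj =>
    if_neg (by omega)
  have hstart : ∀ j, j ≤ b → start N (flushPayload σ.payload s' b) j = start N σ.payload j :=
    fun j hj => start_congr fun i hi => hPlt i (by omega)
  have hlow : ∀ m, s' m ≠ 0 → Nat.log 2 (s' m) < b → s' m = s m := by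
    intro m hm hmb
    refine hu.apply_of_ne ?_
    rintro rfl
    rw [hu.apply_self.resolve_left hm] at hmb
    omega
  have hfill : ∀ j, N * fill (σ.flush N s' b).entries j ≤ (σ.flush N s' b).payload j := by
    intro j
    simp only [State.flush]
    rcases lt_or_ge j b with hj | hj
    · rw [fill_filter_lt hj, hPlt j hj]
      exact h.fill_le j
    · rw [fill_filter_lt_of_le hj]
      simp
  have hloc : ∀ m, s' m ≠ 0 → ∃ j, start N (σ.flush N s' b).payload j ≤ (σ.flush N s' b).place m ∧
    (σ.flush N s' b).place m + s' m ≤ start N (σ.flush N s' b).payload j +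
      (σ.flush N s' b).payload j + fill (σ.flush N s' b).entries j ∧
    ((Nat.log 2 (s' m) = j ∨ (s' m, j) ∈ (σ.flush N s' b).entries)) ∧
      (Nat.log 2 (s' m) < b → j < b) ∧ (b ≤ Nat.log 2 (s' m) → j = Nat.log 2 (s' m)) := by
    intro m hm
    simp only [State.flush]
    by_cases hmb : Nat.log 2 (s' m) < b
    · rw [if_pos hmb]
      have e := hlow m hm hmb
      rw [e] at hm hmb ⊢
      obtain ⟨j, h₁, h₂, h₃⟩ := h.located m hm
      have hj : j < b := by
        rcases h₃ with rfl | h₃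
        · exact hmb
        · exact hb _ h₃ hmb
      refine ⟨j, ?_, ?_, ?_, fun _ => hj, fun h => absurd hmb (by omega)⟩
      · rw [hstart j hj.le]; exact h₁
      · rw [hstart j hj.le, hPlt j hj, fill_filter_lt hj]; exact h₂
      · exact h₃.imp_right fun h => by simp [h, hj]
    · rw [if_neg hmb]
      refine ⟨Nat.log 2 (s' m), by omega, ?_, .inl rfl, fun h => absurd h hmb, fun _ => rfl⟩
      rw [hPge _ (by omega)]
      have := pack_le (mem_classOf.2 ⟨hm, rfl⟩)
      omega
  constructor
  · intro m hm k hk hmk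
    have hm0 : s' m ≠ 0 := by simpa using hm
    have hk0 : s' k ≠ 0 := by simpa using hk
    obtain ⟨i, hi₁, hi₂, -, hi₃, hi₄⟩ := hloc m hm0
    obtain ⟨j, hj₁, hj₂, -, hj₃, hj₄⟩ := hloc k hk0
    by_cases hij : i = j
    · subst hij
      simp only [Function.onFun, State.flush]
      by_cases hmb : Nat.log 2 (s' m) < b
      · have hkb : Nat.log 2 (s' k) < b := by
          by_contra hkb
          have := hj₄ (by omega)
          have := hi₃ hmb
          omega
        rw [if_pos hmb, if_pos hkb]
        have em := hlow m hm0 hmb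
        have ek := hlow k hk0 hkb
        rw [em] at hm0 ⊢
        rw [ek] at hk0 ⊢
        exact h.isAllocation (by simpa using hm0) (by simpa using hk0) hmk
      · have hkb : ¬ Nat.log 2 (s' k) < b := by
          intro hkb
          have := hj₃ hkb
          have := hi₄ (by omega)
          omega
        have e : Nat.log 2 (s' k) = Nat.log 2 (s' m) := by
          rw [← hi₄ (by omega), ← hj₄ (by omega)]
        rw [if_neg hmb, if_neg hkb, e]
        have := pack_disjoint s' (Nat.log 2 (s' m)) (mem_classOf.2 ⟨hm0, rfl⟩)
          (mem_classOf.2 ⟨hk0, e⟩) hmk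
        simp only [Function.onFun, Set.Ico_disjoint_Ico] at this ⊢
        omega
    · exact disjoint_of_region hN hfill hij hi₁ hi₂ hj₁ hj₂
  · intro m hm
    obtain ⟨j, h₁, h₂, h₃, -⟩ := hloc m hm
    exact ⟨j, h₁, h₂, h₃⟩
  · intro p hp
    simp only [State.flush, List.mem_filter, decide_eq_true_eq] at hp ⊢
    obtain ⟨h₁, h₂, h₃⟩ := h.entry p hp.1
    refine ⟨h₁, h₂, fun i hi hij => ?_⟩
    rw [hPlt i (by omega), fill_filter_lt (by omega)]
    exact h₃ i hi hij
  · exact hfill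
  · intro j
    simp only [State.flush]
    rcases lt_or_ge j b with hj | hj
    · rw [hPlt j hj]
      exact h.payload j
    · rw [hPge j hj]
      rcases (classOf s' j).eq_empty_or_nonempty with he | ⟨m, hm⟩
      · left
        simp [classVol, he]
      · right
        have h₁ := mem_classOf.1 hm
        rw [← h₁.2]
        refine (Nat.pow_log_le_self 2 h₁.1).trans ?_
        rw [h₁.2]
        exact Finset.single_le_sum (f := fun m => s' m) (fun _ _ => Nat.zero_le _) hm
  · intro j
    simp only [State.flush]
    rcases lt_or_ge j b with hj | hj
    · rw [hPlt j hj, pending_filter_lt hb hj]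
      have h₁ := hu.classVol_le j
      rw [if_neg (by omega)] at h₁
      exact h₁.trans (h.classVol_le j)
    · rw [hPge j hj]
      omega
  · intro j
    simp only [State.flush]
    rcases lt_or_ge j b with hj | hj
    · rw [hPlt j hj, pending_filter_lt hb hj]
      have h₁ := hu.symm.classVol_le j
      rw [if_neg (by omega)] at h₁
      have := h.le_classVol j
      omega
    · rw [hPge j hj]
      omega

theorem State.Inv.step {N : ℕ} (hN : 0 < N) {s s' : α →₀ ℕ} {σ : State α} {n : α} {w : ℕ}
    (h : σ.Inv N s) (hu : IsUpdate s s' n w) : (σ.step N s' n w).Inv N s' := by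
  classical
  unfold State.step
  split_ifs with hf
  · exact h.record hN hu (Nat.find_spec hf) fun i hi => Nat.find_min hf hi
  · exact h.flush hN hu (isCut_cut _ _) (cut_le _ _)

/-! ### The cost of a step -/

/-- Only `n` receives a new address, and `n` is not active both before and after the request. -/
theorem moveCost_record {f : ℕ → ℝ} {N : ℕ} {s s' : α →₀ ℕ} {σ : State α} {n : α} {w j : ℕ}
    (hu : IsUpdate s s' n w) : moveCost f s s' σ.place (σ.record N n w j).place = 0 := by
  classical
  rw [moveCost, Finset.filter_false_of_mem, Finset.sum_empty]
  rintro m hm ⟨hm', hne⟩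
  have hm0 : s m ≠ 0 := by simpa using hm
  have hmn : m ≠ n := by
    rintro rfl
    rcases hu.apply_self_eq_zero with h | h
    · exact hm0 h
    · exact hm' h
  exact hne (by simp only [State.record, Function.update_of_ne hmn])

/-- The entries that pay for a flush: those of the flushed buffers, and that of the request which
causes the flush, recorded in a fictitious buffer `M`. -/
def payers (E : List (ℕ × ℕ)) (w b M : ℕ) : List (ℕ × ℕ) :=
  (w, M) :: E.filter fun p => ¬ p.2 < b

theorem fill_payers {E : List (ℕ × ℕ)} {w b M j : ℕ} (hj : b ≤ j) (hM : j < M) :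
    fill (payers E w b M) j = fill E j := by
  rw [payers, fill_cons, if_neg (by omega), zero_add]
  exact sum_map_filter_of_eq_zero E _ (fun p => ¬ p.2 < b) fun p _ hp => if_neg (by omega)

/-- Discarding the entries below `b` loses nothing here: an entry never lies in a buffer below its
own class. -/
theorem pending_payers {E : List (ℕ × ℕ)} {w b M j : ℕ} (hE : ∀ p ∈ E, Nat.log 2 p.1 ≤ p.2)
    (hj : b ≤ j) :
    pending (payers E w b M) j = (if Nat.log 2 w = j then w else 0) + pending E j := by
  rw [payers, pending_cons]
  congr 1
  refine sum_map_filter_of_eq_zero E _ (fun p => ¬ p.2 < b) fun p hp hpb => if_neg ?_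
  have := hE p hp
  omega

theorem sum_filter_add_sum_filter_not {ι : Type*} (E : List ι) (g : ι → ℝ) (Q : ι → Prop)
    [DecidablePred Q] : ((E.filter (fun p => Q p)).map g).sum +
      ((E.filter (fun p => ¬ Q p)).map g).sum = (E.map g).sum := by
  induction E with
  | nil => simp
  | cons a E ih =>
    by_cases ha : Q a
    · simp only [ha, decide_true, List.filter_cons_of_pos, List.map_cons, List.sum_cons, not_true,
        decide_false, Bool.false_eq_true, not_false_eq_true, List.filter_cons_of_neg] at ih ⊢
      linarith
    · simp only [ha, decide_false, Bool.false_eq_true, not_false_eq_true, List.filter_cons_of_neg,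
        decide_true, List.filter_cons_of_pos, List.map_cons, List.sum_cons] at ih ⊢
      linarith

/-- Classes below `b` keep their addresses; every object from `b` on is charged as if it moved. -/
theorem moveCost_flush_le {f : ℕ → ℝ} (hf : IsSubadditiveCost f) {N : ℕ} {s s' : α →₀ ℕ}
    {σ : State α} {n : α} {w b M : ℕ} (hu : IsUpdate s s' n w)
    (hM : ∀ m ∈ s'.support, Nat.log 2 (s' m) < M) :
    moveCost f s s' σ.place (σ.flush N s' b).place ≤
      ∑ j ∈ Finset.Ico b M, ∑ m ∈ classOf s' j, f (s' m) := by
  have hpos : ∀ m, s' m ≠ 0 → 0 ≤ f (s' m) := fun m hm => hf.nonneg (Nat.pos_of_ne_zero hm)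
  have hfib : ∑ j ∈ Finset.Ico b M, ∑ m ∈ classOf s' j, f (s' m) =
      ∑ m ∈ s'.support with b ≤ Nat.log 2 (s' m), f (s' m) := by
    rw [← Finset.sum_fiberwise_of_maps_to (t := Finset.Ico b M) (g := fun m => Nat.log 2 (s' m))]
    · refine Finset.sum_congr rfl fun j hj => Finset.sum_congr ?_ fun _ _ => rfl
      ext m
      simp only [mem_classOf, Finset.mem_filter, Finsupp.mem_support_iff]
      have := (Finset.mem_Ico.1 hj).1
      constructor
      · rintro ⟨h₁, h₂⟩
        exact ⟨⟨h₁, by omega⟩, h₂⟩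
      · rintro ⟨⟨h₁, -⟩, h₂⟩
        exact ⟨h₁, h₂⟩
    · intro m hm
      rw [Finset.mem_filter] at hm
      exact Finset.mem_Ico.2 ⟨hm.2, hM m hm.1⟩
  rw [hfib, moveCost]
  have hss : ∀ m, s m ≠ 0 → s' m ≠ 0 → s' m = s m := by
    intro m h₁ h₂
    refine hu.apply_of_ne ?_
    rintro rfl
    exact hu.apply_self_eq_zero.elim h₁ h₂
  calc _ = ∑ m ∈ s.support with s' m ≠ 0 ∧ σ.place m ≠ (σ.flush N s' b).place m, f (s' m) := by
        refine Finset.sum_congr rfl fun m hm => ?_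
        rw [Finset.mem_filter, Finsupp.mem_support_iff] at hm
        rw [hss m hm.1 hm.2.1]
    _ ≤ _ := by
        refine Finset.sum_le_sum_of_subset_of_nonneg ?_ ?_
        · intro m hm
          rw [Finset.mem_filter] at hm ⊢
          refine ⟨by simpa using hm.2.1, ?_⟩
          by_contra hlt
          exact hm.2.2 (by simp only [State.flush]; rw [if_pos (by omega)])
        · intro m hm _
          rw [Finset.mem_filter, Finsupp.mem_support_iff] at hm
          exact hpos m hm.1

/-- The amortization factor. -/
noncomputable def rate (N : ℕ) : ℝ := 2 + 4 * N + 4 * N * (Nat.log 2 N + 3 : ℕ)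

/-- The cost of the requests that are recorded in the buffers. -/
def entryCost (f : ℕ → ℝ) (σ : State α) : ℝ := (σ.entries.map fun p => f p.1).sum

theorem class_price_le {f : ℕ → ℝ} (hf : IsSubadditiveCost f) (s : α →₀ ℕ) {j x : ℕ} (hx : 0 < x)
    (hxj : Nat.log 2 x ≤ j) :
    x * ∑ m ∈ classOf s j, f (s m) ≤ 2 * classVol s j * f x := by
  rw [classVol, Nat.cast_sum, Finset.mul_sum, Finset.mul_sum, Finset.sum_mul]
  refine Finset.sum_le_sum fun m hm => hf.price_le hx ?_
  obtain ⟨h₁, rfl⟩ := mem_classOf.1 hm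
  calc x < 2 ^ (Nat.log 2 x + 1) := Nat.lt_pow_succ_log_self (by norm_num) x
    _ ≤ 2 ^ (Nat.log 2 (s m) + 1) := Nat.pow_le_pow_right (by norm_num) (by omega)
    _ = 2 * 2 ^ Nat.log 2 (s m) := by ring
    _ ≤ 2 * s m := Nat.mul_le_mul_left _ (Nat.pow_log_le_self 2 h₁)

/-- The recorded requests act as a potential: the flush is paid for by the entries it removes
together with the current request. -/
theorem State.Inv.cost_flush {f : ℕ → ℝ} (hf : IsSubadditiveCost f) {N : ℕ} (hN : 0 < N)
    {s s' : α →₀ ℕ} {σ : State α} {n : α} {w : ℕ} (h : σ.Inv N s) (hu : IsUpdate s s' n w)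
    (hno : ¬ ∃ j, Fits N σ w j) :
    moveCost f s s' σ.place (σ.flush N s' (cut σ.entries (Nat.log 2 w))).place +
      rate N * entryCost f (σ.flush N s' (cut σ.entries (Nat.log 2 w))) ≤
      rate N * entryCost f σ + rate N * f w := by
  obtain ⟨b, hb⟩ : ∃ b, b = cut σ.entries (Nat.log 2 w) := ⟨_, rfl⟩
  -- Beyond every active class, so all rebuilt objects are counted, and beyond the class of `w`, so
  -- the fictitious entry is in an admissible buffer.
  obtain ⟨M, hM⟩ : ∃ M, M = Nat.log 2 w + (s'.support.sup fun m => Nat.log 2 (s' m)) + 1 :=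
    ⟨_, rfl⟩
  have hMs : ∀ m ∈ s'.support, Nat.log 2 (s' m) < M := by
    intro m hm
    have := Finset.le_sup (f := fun m => Nat.log 2 (s' m)) hm
    omega
  have hmove := moveCost_flush_le hf (N := N) (σ := σ) (b := b) hu hMs
  have hsum := sum_class_cost_le hf (b := b) (M := M) (P := σ.payload) (v := classVol s')
    (T := fun j => ∑ m ∈ classOf s' j, f (s' m)) hN (payers σ.entries w b M)
    (fun j => Finset.sum_nonneg fun m hm =>
      hf.nonneg (Nat.pos_of_ne_zero (mem_classOf.1 hm).1))
    (fun j x hx hxj => class_price_le hf s' hx hxj)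
    (fun j hj => by
      rw [pending_payers (fun p hp => (h.entry p hp).2.1) hj]
      have h₁ := hu.classVol_le j
      have h₂ := h.classVol_le j
      omega)
    h.payload
    (fun p hp => by
      rcases List.mem_cons.1 hp with rfl | hp
      · exact ⟨hu.1, by simp only; omega⟩
      · have := h.entry p (List.mem_filter.1 hp).1
        exact ⟨this.1, this.2.1⟩)
    (fun j hj hjM => by
      rw [fill_payers hj hjM]
      -- Below the class of `w`, maximality of the cut supplies a request that skipped buffer `j`;
      -- from there on, the current request itself does not fit.
      rcases lt_or_ge j (Nat.log 2 w) with hjw | hjw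
      · obtain ⟨p, hp, h₁, h₂⟩ := exists_of_cut_le (hb ▸ hj) hjw
        refine ⟨p, List.mem_cons_of_mem _ (List.mem_filter.2 ⟨hp, ?_⟩), h₁,
          (h.entry p hp).2.2 j h₁ h₂⟩
        simp only [decide_eq_true_eq]
        omega
      · refine ⟨(w, M), List.mem_cons_self, hjw, ?_⟩
        by_contra hc
        exact hno ⟨j, hjw, by simpa using hc⟩)
  have hsplit := sum_filter_add_sum_filter_not σ.entries (fun p => f p.1) (fun p => p.2 < b)
  rw [← hb]
  have hpay : ((payers σ.entries w b M).map fun p => f p.1).sum =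
      f w + ((σ.entries.filter fun p => ¬ p.2 < b).map fun p => f p.1).sum := by
    simp only [payers, List.map_cons, List.sum_cons]
  rw [hpay, ← rate] at hsum
  simp only [entryCost]
  rw [← hsplit]
  simp only [State.flush] at hmove ⊢
  linarith

theorem State.Inv.cost_step {f : ℕ → ℝ} (hf : IsSubadditiveCost f) {N : ℕ} (hN : 0 < N)
    {s s' : α →₀ ℕ} {σ : State α} {n : α} {w : ℕ} (h : σ.Inv N s) (hu : IsUpdate s s' n w) :
    moveCost f s s' σ.place (σ.step N s' n w).place + rate N * entryCost f (σ.step N s' n w) ≤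
      rate N * entryCost f σ + rate N * f w := by
  classical
  unfold State.step
  split_ifs with hfit
  · rw [moveCost_record hu]
    simp only [entryCost, State.record, List.map_cons, List.sum_cons]
    linarith
  · exact h.cost_flush hf hN hu hfit

/-! ### The reallocator -/

/-- The state after the requests of a history. -/
noncomputable def run (N : ℕ) : List (Request α) → State α
  | [] => ⟨fun _ => 0, [], fun _ => 0⟩
  | Request.insert n w :: h => (run N h).step N (active (Request.insert n w :: h)) n w
  | Request.delete n :: h => (run N h).step N (active (Request.delete n :: h)) n (active h n)

theorem isUpdate_insert {h : List (Request α)} {n : α} {w : ℕ}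
    (hh : IsExecution (Request.insert n w :: h)) :
    IsUpdate (active h) (active (Request.insert n w :: h)) n w :=
  ⟨hh.2.2, .inl ⟨by simpa using hh.2.1, rfl⟩⟩

theorem isUpdate_delete {h : List (Request α)} {n : α}
    (hh : IsExecution (Request.delete n :: h)) :
    IsUpdate (active h) (active (Request.delete n :: h)) n (active h n) := by
  refine ⟨Nat.pos_of_ne_zero (by simpa using hh.2), .inr ⟨by simp [active], ?_⟩⟩
  simp [active]

theorem run_inv {N : ℕ} (hN : 0 < N) (h : List (Request α)) (hh : IsExecution h) :
    (run N h).Inv N (active h) := by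
  induction h with
  | nil =>
    constructor <;> simp [run, active, IsAllocation, fill, pending, classVol, classOf]
  | cons r h ih =>
    cases r with
    | insert n w => exact (ih hh.1).step hN (isUpdate_insert hh)
    | delete n => exact (ih hh.1).step hN (isUpdate_delete hh)

/-- The reallocator whose buffers take up a fraction `1 / N` of the payload segments. -/
noncomputable def bufferedReallocator (α : Type u) {N : ℕ} (hN : 0 < N) : Reallocator α where
  place h := (run N h).place
  isAllocation h hh := (run_inv hN h hh).isAllocation

/-- The factor 2 covers two requests per object. The sum over active objects is credit for their
future deletions, released when these occur and then charged like an insertion. -/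
theorem reallocCost_le {f : ℕ → ℝ} (hf : IsSubadditiveCost f) {N : ℕ} (hN : 0 < N)
    (h : List (Request α)) (hh : IsExecution h) :
    reallocCost f (bufferedReallocator α hN) h + rate N * entryCost f (run N h) +
      rate N * ∑ m ∈ (active h).support, f (active h m) ≤ rate N * (2 * allocCost f h) := by
  induction h with
  | nil => simp [reallocCost, entryCost, run, active, allocCost]
  | cons r h ih =>
    cases r with
    | insert n w =>
      have ih := ih hh.1
      have hu := isUpdate_insert hh
      have hc := (run_inv hN h hh.1).cost_step hf hN hu
      have hs := sum_support_update (active h) (n := n) (w := w) (by simpa using hh.2.1) hh.2.2 f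
      rw [← active] at hs
      simp only [reallocCost, allocCost, bufferedReallocator, run] at ih ⊢
      rw [hs]
      linarith
    | delete n =>
      have ih := ih hh.1
      have hu := isUpdate_delete hh
      have hc := (run_inv hN h hh.1).cost_step hf hN hu
      have h₁ : active (Request.delete n :: h) n = 0 := by simp [active]
      have h₂ : active h = (active (Request.delete n :: h)).update n (active h n) := by
        rcases hu.2 with ⟨h0, -⟩ | ⟨-, h⟩
        · exact absurd h0 hu.1.ne'
        · exact h
      have hs := sum_support_update (active (Request.delete n :: h)) (n := n) (w := active h n)
        h₁ hu.1 f
      rw [← h₂] at hs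
      rw [hs] at ih
      simp only [reallocCost, allocCost, bufferedReallocator, run] at ih ⊢
      linarith

theorem reallocCost_le_allocCost {f : ℕ → ℝ} (hf : IsSubadditiveCost f) {N : ℕ} (hN : 0 < N)
    (h : List (Request α)) (hh : IsExecution h) :
    reallocCost f (bufferedReallocator α hN) h ≤ 2 * rate N * allocCost f h := by
  have h₁ := reallocCost_le hf hN h hh
  have hr : 0 ≤ rate N := by unfold rate; positivity
  have h₂ : 0 ≤ entryCost f (run N h) := List.sum_nonneg (by
    simp only [List.mem_map, forall_exists_index, and_imp]
    rintro _ p hp rfl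
    exact hf.nonneg ((run_inv hN h hh).entry p hp).1)
  have h₃ : 0 ≤ ∑ m ∈ (active h).support, f (active h m) := Finset.sum_nonneg fun m hm =>
    hf.nonneg (Nat.pos_of_ne_zero (by simpa using hm))
  have h₄ := mul_nonneg hr h₂
  have h₅ := mul_nonneg hr h₃
  linarith

theorem allocCost_nonneg {f : ℕ → ℝ} (hf : IsSubadditiveCost f) (h : List (Request α))
    (hh : IsExecution h) : 0 ≤ allocCost f h := by
  induction h with
  | nil => exact le_rfl
  | cons r h ih =>
    cases r with
    | insert n w => exact add_nonneg (ih hh.1) (hf.nonneg hh.2.2)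
    | delete n => exact ih hh.1

/-! ### The footprint -/

theorem volume_le_footprint {s : α →₀ ℕ} {y : α → ℕ} (hy : IsAllocation s y) :
    volume s ≤ footprint s y := by
  classical
  have hd : (s.support : Set α).PairwiseDisjoint fun m => Finset.Ico (y m) (y m + s m) := by
    intro m hm k hk hmk
    have := hy hm hk hmk
    simp only [Function.onFun] at this ⊢
    rw [← Finset.disjoint_coe]
    simpa using this
  calc volume s = (s.support.biUnion fun m => Finset.Ico (y m) (y m + s m)).card := by
        rw [Finset.card_biUnion hd]
        simp [volume]
    _ ≤ (Finset.range (footprint s y)).card := by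
        refine Finset.card_le_card fun c hc => ?_
        obtain ⟨m, hm, hc⟩ := Finset.mem_biUnion.1 hc
        have := Finset.le_sup (f := fun m => y m + s m) hm
        exact Finset.mem_range.2 ((Finset.mem_Ico.1 hc).2.trans_le this)
    _ = footprint s y := Finset.card_range _

/-- Both sides add up the lengths of all entries, grouped once by buffer and once by class. -/
theorem sum_fill_eq_sum_pending {E : List (ℕ × ℕ)} {M : ℕ}
    (hE : ∀ p ∈ E, Nat.log 2 p.1 ≤ p.2 ∧ p.2 < M) :
    ∑ j ∈ Finset.range M, fill E j = ∑ j ∈ Finset.range M, pending E j := by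
  induction E with
  | nil => simp [fill, pending]
  | cons p E ih =>
    have h₁ := hE p (by simp)
    have h₂ := ih fun p hp => hE p (by simp [hp])
    obtain ⟨w, i⟩ := p
    simp only at h₁
    simp only [fill_cons, pending_cons, Finset.sum_add_distrib, h₂, Finset.sum_ite_eq,
      Finset.mem_range]
    rw [if_pos h₁.2, if_pos (by omega)]

theorem State.Inv.footprint_le {N : ℕ} (hN : 0 < N) {s : α →₀ ℕ} {σ : State α}
    (h : σ.Inv N s) : (N - 1 : ℝ) * footprint s σ.place ≤ (N + 1) * volume s := by
  obtain ⟨M, hM⟩ : ∃ M, M = (s.support.sup fun m => Nat.log 2 (s m)) +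
    (σ.entries.map fun p => p.2).sum + 1 := ⟨_, rfl⟩
  have hMs : ∀ m ∈ s.support, Nat.log 2 (s m) < M := by
    intro m hm
    have := Finset.le_sup (f := fun m => Nat.log 2 (s m)) hm
    omega
  have hME : ∀ p ∈ σ.entries, p.2 < M := by
    intro p hp
    have := List.single_le_sum (l := σ.entries.map fun p => p.2) (by simp) p.2
      (List.mem_map_of_mem (f := fun p : ℕ × ℕ => p.2) hp)
    omega
  have hfoot : footprint s σ.place ≤ start N σ.payload M := by
    refine Finset.sup_le fun m hm => ?_
    obtain ⟨j, h₁, h₂, h₃⟩ := h.located m (by simpa using hm)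
    have hj : j < M := by
      rcases h₃ with rfl | h₃
      · exact hMs m hm
      · exact hME _ h₃
    have h₄ := start_mono N σ.payload (Nat.succ_le_of_lt hj)
    have h₅ := (Nat.le_div_iff_mul_le hN).2 (mul_comm N _ ▸ h.fill_le j)
    rw [Nat.succ_eq_add_one, start_succ] at h₄
    omega
  obtain ⟨Q, hQ⟩ : ∃ Q, Q = ∑ j ∈ Finset.range M, σ.payload j := ⟨_, rfl⟩
  have hstart : N * start N σ.payload M ≤ (N + 1) * Q := by
    rw [start, hQ, Finset.mul_sum, Finset.mul_sum]
    refine Finset.sum_le_sum fun j _ => ?_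
    have := Nat.mul_div_le (σ.payload j) N
    rw [mul_add, add_mul]
    omega
  have hfill : N * ∑ j ∈ Finset.range M, fill σ.entries j ≤ Q := by
    rw [hQ, Finset.mul_sum]
    exact Finset.sum_le_sum fun j _ => h.fill_le j
  have hQV : Q ≤ volume s + ∑ j ∈ Finset.range M, fill σ.entries j := by
    rw [sum_fill_eq_sum_pending fun p hp => ⟨(h.entry p hp).2.1, hME p hp⟩,
      ← sum_classVol s hMs, hQ, ← Finset.sum_add_distrib]
    exact Finset.sum_le_sum fun j _ => h.le_classVol j
  generalize (∑ j ∈ Finset.range M, fill σ.entries j) = F at hfill hQV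
  have hN1 : (1 : ℝ) ≤ N := by exact_mod_cast hN
  have e₁ : (N : ℝ) * footprint s σ.place ≤ (N + 1) * Q := by
    exact_mod_cast (Nat.mul_le_mul_left N hfoot).trans hstart
  have e₂ : (N : ℝ) * F ≤ Q := by exact_mod_cast hfill
  have e₃ : (Q : ℝ) ≤ volume s + F := by exact_mod_cast hQV
  -- Combines `Q ≤ volume s + F` with `N * F ≤ Q`: the payloads exceed the volume by a factor of at
  -- most `N / (N - 1)`, and buffers add a further `(N + 1) / N`.
  have e₄ : (N - 1 : ℝ) * Q ≤ N * volume s := by nlinarith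
  have e₅ : (N : ℝ) * ((N - 1 : ℝ) * footprint s σ.place) ≤ N * ((N + 1) * volume s) := by
    calc (N : ℝ) * ((N - 1 : ℝ) * footprint s σ.place)
        = (N - 1) * (N * footprint s σ.place) := by ring
      _ ≤ (N - 1) * ((N + 1) * Q) := mul_le_mul_of_nonneg_left e₁ (by linarith)
      _ = (N + 1) * ((N - 1) * Q) := by ring
      _ ≤ (N + 1) * (N * volume s) := mul_le_mul_of_nonneg_left e₄ (by linarith)
      _ = N * ((N + 1) * volume s) := by ring
  exact le_of_mul_le_mul_left e₅ (by linarith)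

theorem footprint_le_volume {N : ℕ} (hN : 0 < N) {ε : ℝ} (hε : 0 < ε) (hε' : ε ≤ 1 / 2)
    (hNε : 4 / ε ≤ N) (h : List (Request α)) (hh : IsExecution h) :
    (footprint (active h) ((bufferedReallocator α hN).place h) : ℝ) ≤
      (1 + ε) * volume (active h) := by
  have h₁ := (run_inv hN h hh).footprint_le hN
  have h₂ : 4 ≤ N * ε := by rwa [div_le_iff₀ hε] at hNε
  have h₃ : (1 : ℝ) < N := by nlinarith
  -- Amounts to `2 + ε ≤ N * ε`, for which `4 ≤ N * ε` leaves room.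
  have h₄ : (N + 1 : ℝ) ≤ (N - 1) * (1 + ε) := by nlinarith
  refine le_of_mul_le_mul_left (h₁.trans ?_) (by linarith : (0 : ℝ) < N - 1)
  rw [← mul_assoc]
  gcongr

theorem rate_le {N : ℕ} {ε : ℝ} (hε : 0 < ε) (hε' : ε ≤ 1 / 2) (hN : 1 ≤ N)
    (hNε : (N : ℝ) ≤ 5 / ε) :
    2 * rate N ≤ 340 / Real.log 2 * (1 / ε * Real.log (1 / ε)) := by
  have hl2 : 0 < Real.log 2 := Real.log_pos (by norm_num)
  obtain ⟨l, hl⟩ : ∃ l, l = Real.log (1 / ε) / Real.log 2 := ⟨_, rfl⟩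
  -- The only use of `ε ≤ 1 / 2`: it lets the terms without a logarithm be absorbed into `N * l`.
  have hl1 : 1 ≤ l := by
    rw [hl, le_div_iff₀ hl2, one_mul]
    exact Real.log_le_log (by norm_num) (by rw [le_div_iff₀ hε]; linarith)
  have hlog : (Nat.log 2 N : ℝ) ≤ 3 + l := by
    have h₁ : (Nat.log 2 N : ℝ) * Real.log 2 ≤ Real.log N := by
      rw [← Real.log_pow]
      exact Real.log_le_log (by positivity) (by exact_mod_cast Nat.pow_log_le_self 2 (by omega))
    have h₂ : Real.log N ≤ Real.log (2 ^ 3 * (1 / ε)) := by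
      refine Real.log_le_log (by exact_mod_cast hN) (hNε.trans ?_)
      rw [mul_one_div]
      gcongr
      norm_num
    rw [Real.log_mul (by norm_num) (by positivity), Real.log_pow] at h₂
    have h₃ : Real.log (1 / ε) = l * Real.log 2 := by rw [hl]; field_simp
    rw [h₃] at h₂
    refine le_of_mul_le_mul_right (h₁.trans (h₂.trans ?_)) hl2
    push_cast
    linarith
  have hN1 : (1 : ℝ) ≤ N := by exact_mod_cast hN
  have hrhs : 340 / Real.log 2 * (1 / ε * Real.log (1 / ε)) = 68 * (5 / ε * l) := by
    rw [hl]
    field_simp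
    ring
  rw [hrhs, rate]
  push_cast
  have h₁ : (N : ℝ) * l ≤ 5 / ε * l := by gcongr
  have h₂ : (N : ℝ) ≤ N * l := by nlinarith
  have h₃ : (N : ℝ) * Nat.log 2 N ≤ N * (3 + l) := by gcongr
  -- Twice the rate is `4 + 32 * N + 8 * N * Nat.log 2 N`, at most `(4 + 32 + 24 + 8) * N * l`; this
  -- is the 68, and `340 = 68 * 5`.
  linarith

end StorageRealloc

theorem mainTheorem1 :
    ∃ C : ℝ, 0 < C ∧
      ∀ (α : Type*) (ε : ℝ), 0 < ε → ε ≤ 1 / 2 →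
        ∃ A : StorageRealloc.Reallocator α,
          (∀ f : ℕ → ℝ, StorageRealloc.IsSubadditiveCost f →
            A.IsCompetitive f (1 + ε) (C * (1 / ε * Real.log (1 / ε)))) ∧
          ∀ h : List (StorageRealloc.Request α), StorageRealloc.IsExecution h →
            (StorageRealloc.footprint (StorageRealloc.active h) (A.place h) : ℝ) ≤
              (1 + ε) * StorageRealloc.volume (StorageRealloc.active h) := by
  refine ⟨340 / Real.log 2, div_pos (by norm_num) (Real.log_pos (by norm_num)), ?_⟩
  intro α ε hε hε'
  have hN : 0 < ⌈4 / ε⌉₊ := Nat.ceil_pos.2 (by positivity)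
  have hle : 4 / ε ≤ ⌈4 / ε⌉₊ := Nat.le_ceil _
  have hge : (⌈4 / ε⌉₊ : ℝ) ≤ 5 / ε := by
    refine (Nat.ceil_lt_add_one (by positivity)).le.trans ?_
    have : 1 ≤ 1 / ε := by rw [le_div_iff₀ hε]; linarith
    calc 4 / ε + 1 ≤ 4 / ε + 1 / ε := by gcongr
      _ = 5 / ε := by ring
  have hfoot := StorageRealloc.footprint_le_volume (α := α) hN hε hε' hle
  refine ⟨StorageRealloc.bufferedReallocator α hN, fun f hf h hh => ⟨fun y hy => ?_, ?_⟩, hfoot⟩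
  · refine (hfoot h hh).trans ?_
    gcongr
    exact StorageRealloc.volume_le_footprint hy
  · exact (StorageRealloc.reallocCost_le_allocCost hf hN h hh).trans
      (mul_le_mul_of_nonneg_right (StorageRealloc.rate_le hε hε' hN hge)
        (StorageRealloc.allocCost_nonneg hf h hh))
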